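/- Let $H=(H_1,\dots,H_n,p_1,\dots,p_n)$, $n>1$, be a finite strategic game: each $H_i$ is a finite non-empty set and $p_i:H_1\times\dots\times H_n\to\mathbb R$. A restriction of $H$ is a sequence $G=(G_1,\dots,G_n)$ with $G_i\subseteq H_i$; restrictions are ordered componentwise by inclusion, with largest element $H$, and $G_{-i}=\prod_{j\ne i}G_j$. For a finite set $A$ let $\Delta A$ be the set of probability distributions on $A$ (so $\Delta\emptyset=\emptyset$); payoffs are extended to mixed strategies and to distributions over the opponents' joint strategies by expectation. For a restriction $G$, a player $i$, $s_i\in H_i$ and $C\subseteq H_i$, say that relative to $C$ the strategy $s_i$ is, on $G$, * $sd$-optimal if there is no $t\in C$ with $p_i(t,s_{-i})>p_i(s_i,s_{-i})$ for all $s_{-i}\in G_{-i}$; * $wd$-optimal if there is no $t\in C$ with $p_i(t,s_{-i})\ge p_i(s_i,s_{-i})$ for all $s_{-i}\in G_{-i}$, with strict inequality for some $s_{-i}\in G_{-i}$; * $msd$-optimal, respectively $mwd$-optimal, if the same holds with mixed strategies $m\in\Delta C$ in place of $t\in C$; * $br$-optimal if there is a belief $\mu$ of player $i$ held in $G$ with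 $p_i(s_i,\mu)\ge p_i(t,\mu)$ for all $t\in C$. Here one of three kinds of beliefs is fixed throughout: joint strategies ($\mu\in G_{-i}$), joint mixed strategies ($\mu=(m_j)_{j\ne i}$ with $m_j\in\Delta G_j$), or correlated strategies ($\mu\in\Delta G_{-i}$). For $\phi\in\{sd,msd,wd,mwd,br\}$ the local property $\phi^l_i(s_i,G)$ is $\phi$-optimality of $s_i$ on $G$ relative to $C=G_i$, and the global property $\phi^g_i(s_i,G)$ is $\phi$-optimality on $G$ relative to $C=H_i$. Let $T_{\phi^l}(G)=(G_1',\dots,G_n')$ with $G_i'=\{s_i\in G_i: \phi^l_i(s_i,G)\}$. Put $T^0=H$, $T^{\alpha+1}=T_{\phi^l}(T^\alpha)$, and $T^\beta=\bigcap_{\alpha<\beta}T^\alpha$ for limit ordinals $\beta$; the outcome $T^\infty_{\phi^l}$ is $T^{\alpha}$ for the least $\alpha$ with $T^{\alpha+1}=T^\alpha$. A knowledge model consists of a set $\Omega$ of states, functions $\overline{s_i}:\Omega\to H_i$, and for each player $i$ a map $P_i:\Omega\to\mathcal P(\Omega)$ such that $\omega\in P_i(\omega)$, and $\omega'\in P_i(\omega)$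 implies $P_i(\omega')=P_i(\omega)$. The standard knowledge model for a restriction $G$ has $\Omega=G_1\times\dots\times G_n$, $\overline{s_i}(\omega)=\omega_i$ and $P_i(\omega)=\{\omega'\in\Omega:\omega'_i=\omega_i\}$. In a knowledge model, for $E\subseteq\Omega$ let $G_E=(\overline{s_1}(E),\dots,\overline{s_n}(E))$, and let $\langle\phi^g_i\rangle=\{\omega\in\Omega:\phi^g_i(\overline{s_i}(\omega),G_{P_i(\omega)})\}$ be the event that player $i$ is $\phi^g_i$-rational. The effect of the public announcements of $\langle\phi^g\rangle$ on the model is the knowledge model obtained by restricting $\Omega$, all $\overline{s_i}$ and all $P_i$ to $\bigcap_{i=1}^n\langle\phi^g_i\rangle$ (the events being computed in that model). Let $\mathcal M^0$ be the standard knowledge model for $H$, let $\mathcal M^{\alpha+1}$ be the effect of the public announcements of $\langle\phi^g\rangle$ on $\mathcal M^\alpha$, and for limit ordinals $\beta$ let $\mathcal M^\beta$ be the intersection of the models $\mathcal M^\alpha$, $\alpha<\beta$; let $\langle\phi^g\rangle^\infty$ be $\mathcal M^\alpha$ for the least $\alpha$ with $\mathcal M^{\alpha+1}=\mathcal M^\alpha$.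 **Theorem.** For each $\phi\in\{sd,msd,wd,mwd,br\}$ (and, for $br$, each of the three kinds of beliefs), the outcomes $T^\infty_{\phi^l}$ and $\langle\phi^g\rangle^\infty$ exist, and $\langle\phi^g\rangle^\infty$ is the standard knowledge model for the restriction $T^\infty_{\phi^l}$. -/

import Mathlib

noncomputable section

namespace EpistemicGames

universe u v

/-! ### Games, restrictions, and operators on restrictions

A game with `n` players is given by its strategy sets `S i` and its payoff functions
`p i : (∀ j, S j) → ℝ`. -/

/-- A restriction of the game: a set `G i ⊆ S i` for each player. With the componentwise inclusion
this is a complete lattice, whose top element is the initial game. -/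
abbrev Restriction {n : ℕ} (S : Fin n → Type u) : Type u := ∀ i, Set (S i)

/-- Joint strategies of the opponents of player `i`. -/
abbrev Opp {n : ℕ} (S : Fin n → Type u) (i : Fin n) : Type u := ∀ j : {j : Fin n // j ≠ i}, S j

/-- The joint strategy `(s_i, s_{-i})`. -/
def joint {n : ℕ} {S : Fin n → Type u} (i : Fin n) (si : S i) (o : Opp S i) : ∀ j, S j :=
  (Equiv.piSplitAt i S).symm (si, o)

/-- `G_{-i}`: the joint strategies of the opponents of `i` in the restriction `G`. -/
def oppSet {n : ℕ} {S : Fin n → Type u} (G : Restriction S) (i : Fin n) : Set (Opp S i) :=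
  {o | ∀ j : {j : Fin n // j ≠ i}, o j ∈ G j}

/-- `Δ A`: the probability distributions on the finite type `X` that are concentrated on `A`. -/
def Delta {X : Type u} [Fintype X] (A : Set X) : Set (X → ℝ) :=
  {m | m ∈ stdSimplex ℝ X ∧ ∀ x, x ∉ A → m x = 0}

/-- A property `φ_i(s_i, G)` for each player `i`. -/
abbrev OptProperty {n : ℕ} (S : Fin n → Type u) : Type u :=
  ∀ i : Fin n, S i → Restriction S → Prop

/-- The operator `T_φ`, which removes from each `G i` the strategies that are not
`φ i`-optimal in `G`. -/
def elim {n : ℕ} {S : Fin n → Type u} (φ : OptProperty S) (G : Restriction S) : Restriction S :=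
  fun i => {s | s ∈ G i ∧ φ i s G}

/-- The transfinite iterations `T^α` of an operator on a complete lattice, starting from `⊤`. -/
def iter {D : Type u} [CompleteLattice D] (T : D → D) (α : Ordinal.{u}) : D :=
  Ordinal.limitRecOn (motive := fun _ => D) α ⊤ (fun _ x => T x)
    (fun β _ x => ⨅ a : Set.Iio β, x a.1 a.2)

/-- `y` is the outcome of the ordinal-indexed sequence `x`: its value at the closure ordinal, the
least `α` with `x (α + 1) = x α` (so that this implies that the closure ordinal exists). -/
def IsOutcome {X : Type v} (x : Ordinal.{u} → X) (y : X) : Prop :=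
  ∃ α, IsLeast {α | x (α + 1) = x α} α ∧ y = x α

/-! ### The notions of optimality -/

/-- The expected payoff of player `i` for the mixed strategy `m` against `o`. -/
def mixedPayoff {n : ℕ} {S : Fin n → Type u} [∀ i, Fintype (S i)]
    (p : Fin n → (∀ j, S j) → ℝ) (i : Fin n) (m : S i → ℝ) (o : Opp S i) : ℝ :=
  ∑ t, m t * p i (joint i t o)

/-- The expected payoff of player `i` for `s` against the distribution `m` on the joint strategies
of the opponents. -/
def beliefPayoff {n : ℕ} {S : Fin n → Type u} [∀ i, Fintype (S i)]
    (p : Fin n → (∀ j, S j) → ℝ) (i : Fin n) (s : S i) (m : Opp S i → ℝ) : ℝ :=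
  ∑ o, m o * p i (joint i s o)

/-- The three kinds of beliefs about the opponents: joint strategies, joint mixed strategies
and correlated strategies. -/
inductive BeliefKind
  | pureJoint
  | mixedJoint
  | correlated

/-- `s` is a best response among the strategies in `C` to some belief of the given kind
held in `G`. -/
def IsBestResponse {n : ℕ} {S : Fin n → Type u} [∀ i, Fintype (S i)]
    (p : Fin n → (∀ j, S j) → ℝ) (b : BeliefKind) (i : Fin n) (s : S i)
    (G : Restriction S) (C : Set (S i)) : Prop :=
  match b with
  | .pureJoint => ∃ o ∈ oppSet G i, ∀ t ∈ C, p i (joint i t o) ≤ p i (joint i s o)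
  | .mixedJoint => ∃ m : ∀ j : {j : Fin n // j ≠ i}, S j → ℝ, 
      (∀ j : {j : Fin n // j ≠ i}, m j ∈ Delta (G j)) ∧
      ∀ t ∈ C, beliefPayoff p i t (fun o => ∏ j, m j (o j)) ≤
        beliefPayoff p i s (fun o => ∏ j, m j (o j))
  | .correlated => ∃ m ∈ Delta (oppSet G i), ∀ t ∈ C, beliefPayoff p i t m ≤ beliefPayoff p i s m

/-- The notions of optimality: not strictly dominated by a pure (`sd`) or mixed (`msd`) strategy,
not weakly dominated by a pure (`wd`) or mixed (`mwd`) strategy, best response to some belief of a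
given kind (`br`). -/
inductive Criterion
  | sd
  | msd
  | wd
  | mwd
  | br (b : BeliefKind)

/-- `s` is optimal for player `i` on `G` according to the criterion, when compared with the
strategies in `C` (for `msd` and `mwd`: the mixed strategies over `C`). -/
def Criterion.Holds {n : ℕ} {S : Fin n → Type u} [∀ i, Fintype (S i)]
    (p : Fin n → (∀ j, S j) → ℝ) (φ : Criterion) (i : Fin n) (s : S i)
    (G : Restriction S) (C : Set (S i)) : Prop :=
  match φ with
  | .sd => ¬ ∃ t ∈ C, ∀ o ∈ oppSet G i, p i (joint i s o) < p i (joint i t o)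
  | .msd => ¬ ∃ m ∈ Delta C, ∀ o ∈ oppSet G i, p i (joint i s o) < mixedPayoff p i m o
  | .wd => ¬ ∃ t ∈ C, (∀ o ∈ oppSet G i, p i (joint i s o) ≤ p i (joint i t o)) ∧
      ∃ o ∈ oppSet G i, p i (joint i s o) < p i (joint i t o)
  | .mwd => ¬ ∃ m ∈ Delta C, (∀ o ∈ oppSet G i, p i (joint i s o) ≤ mixedPayoff p i m o) ∧
      ∃ o ∈ oppSet G i, p i (joint i s o) < mixedPayoff p i m o
  | .br b => IsBestResponse p b i s G C

/-- The local property `φ^l`: comparison with the strategies in the restriction. -/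
def Criterion.localProp {n : ℕ} {S : Fin n → Type u} [∀ i, Fintype (S i)]
    (φ : Criterion) (p : Fin n → (∀ j, S j) → ℝ) : OptProperty S :=
  fun i s G => φ.Holds p i s G (G i)

/-- The global property `φ^g`: comparison with the strategies in the initial game. -/
def Criterion.globalProp {n : ℕ} {S : Fin n → Type u} [∀ i, Fintype (S i)]
    (φ : Criterion) (p : Fin n → (∀ j, S j) → ℝ) : OptProperty S :=
  fun i s G => φ.Holds p i s G Set.univ

/-! ### Knowledge models and public announcements -/

/-- A knowledge model: a set of states (in an ambient type `W`, so that models arising from one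
another by announcements can be intersected), the strategy of each player in each state, and for
each player a knowledge correspondence on the states. -/
@[ext]
structure KnowledgeModel {n : ℕ} (S : Fin n → Type u) (W : Type u) where
  /-- the set of states -/
  states : Set W
  /-- the strategy chosen by each player in each state -/
  str : ∀ i : Fin n, states → S i
  /-- the possibility correspondence of each player -/
  poss : Fin n → states → Set states
  mem_poss : ∀ i ω, ω ∈ poss i ω
  poss_eq : ∀ i ω ω', ω' ∈ poss i ω → poss i ω' = poss i ω

/-- `G_E`: the restriction of the game determined by an event `E` in a model. -/
def KnowledgeModel.eventRestriction {n : ℕ} {S : Fin n → Type u} {W : Type u}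
    (M : KnowledgeModel S W) (E : Set M.states) : Restriction S :=
  fun i => M.str i '' E

/-- `⟨φ_i⟩`: the event that player `i` is `φ_i`-rational. -/
def KnowledgeModel.ratEvent {n : ℕ} {S : Fin n → Type u} {W : Type u}
    (M : KnowledgeModel S W) (φ : OptProperty S) (i : Fin n) : Set M.states :=
  {ω | φ i (M.str i ω) (M.eventRestriction (M.poss i ω))}

/-- The effect of the public announcements `E i` of the players `i`: the states, the strategy
functions and the possibility correspondences are restricted to `⋂ i, E i`. -/
def KnowledgeModel.announce {n : ℕ} {S : Fin n → Type u} {W : Type u}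
    (M : KnowledgeModel S W) (E : Fin n → Set M.states) : KnowledgeModel S W where
  states := {w | ∃ h : w ∈ M.states, ∀ i, (⟨w, h⟩ : M.states) ∈ E i}
  str i ω := M.str i ⟨ω.1, ω.2.1⟩
  poss i ω := {ω' | (⟨ω'.1, ω'.2.1⟩ : M.states) ∈ M.poss i ⟨ω.1, ω.2.1⟩}
  mem_poss i ω := M.mem_poss i _
  poss_eq i ω ω' h := by
    ext x
    exact Set.ext_iff.1 (M.poss_eq i _ _ h) ⟨x.1, x.2.1⟩

/-- The intersection of a nonempty family of models: intersection of the sets of states and of the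
possibility correspondences. It is used for families whose members are successive restrictions of
one model, so that the strategy functions agree on the common states and any of them can be taken. -/
def KnowledgeModel.inter {n : ℕ} {S : Fin n → Type u} {W : Type u} {J : Type v} [Nonempty J]
    (M : J → KnowledgeModel S W) : KnowledgeModel S W where
  states := {w | ∀ j, w ∈ (M j).states}
  str i ω := (M (Classical.arbitrary J)).str i ⟨ω.1, ω.2 _⟩
  poss i ω := {ω' | ∀ j, (⟨ω'.1, ω'.2 j⟩ : (M j).states) ∈ (M j).poss i ⟨ω.1, ω.2 j⟩}
  mem_poss i ω j := (M j).mem_poss i _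
  poss_eq i ω ω' h := by
    ext x
    exact forall_congr' fun j => Set.ext_iff.1 ((M j).poss_eq i _ _ (h j)) ⟨x.1, x.2 j⟩

/-- The standard knowledge model for a restriction `G`: the states are the joint strategies in `G`,
the strategy functions are the projections, and each player knows exactly his own strategy. -/
def standardKnowledgeModel {n : ℕ} {S : Fin n → Type u} (G : Restriction S) :
    KnowledgeModel S (∀ i, S i) where
  states := {s | ∀ i, s i ∈ G i}
  str i ω := ω.1 i
  poss i ω := {ω' | ω.1 i = ω'.1 i}
  mem_poss _ _ := rfl
  poss_eq i ω ω' h := by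
    ext x
    exact ⟨fun hx => Eq.trans h hx, fun hx => Eq.trans (Eq.symm h) hx⟩

/-- The transfinite iteration of the public announcements of `⟨φ_1⟩, …, ⟨φ_n⟩`, starting with the
model `M`, with intersections at limit ordinals. -/
def iterAnnounce {n : ℕ} {S : Fin n → Type u} {W : Type u} (φ : OptProperty S)
    (M : KnowledgeModel S W) (α : Ordinal.{u}) : KnowledgeModel S W :=
  Ordinal.limitRecOn (motive := fun _ => KnowledgeModel S W) α M
    (fun _ N => N.announce (N.ratEvent φ))
    (fun β hβ x =>
      haveI : Nonempty (Set.Iio β) := ⟨⟨0, hβ.bot_lt⟩⟩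
      KnowledgeModel.inter (fun a : Set.Iio β => x a.1 a.2))

end EpistemicGames

end

open EpistemicGames

namespace EpistemicGames

universe u v w

/-! ### Outcomes reached after finitely many steps -/

/-! In the standard model of `G`, what player `i` considers possible at a state fixes only the
strategy of `i`; the opponents range over all of `G`. Global optimality looks at `G` only through
the opponents' components, so one announcement turns the standard model of `G` into that of `elim
(φ.globalProp p) G` (`announce_standard`).

It remains to compare local with global elimination, starting from the whole game. The invariant is
`Criterion.Matched`: whatever a player has lost is still weakly bettered by something available.
Under it the two properties agree (`localProp_iff`), and it survives local elimination
(`elim_localProp`) because a maximiser of total payoff, or a best response to a given belief, is not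
eliminated. Hence the iterates agree stage by stage.

Finiteness stops everything at a natural number, and nonempty restrictions are recovered from their
standard models, so both sequences stop at the same stage. -/

/-- Every ordinal below a natural number is a natural number, so limit stages never enter the check
of leastness. -/
lemma isOutcome_of_nat {X : Type v} (x : Ordinal.{u} → X) (k : ℕ)
    (hk : x ((k + 1 : ℕ) : Ordinal) = x (k : Ordinal))
    (hlt : ∀ j < k, x ((j + 1 : ℕ) : Ordinal) ≠ x (j : Ordinal)) :
    IsOutcome x (x (k : Ordinal)) := by
  refine ⟨k, ⟨?_, ?_⟩, rfl⟩
  · simpa using hk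
  · intro α hα
    by_contra hlt'
    rw [not_le] at hlt'
    obtain ⟨j, rfl⟩ := Ordinal.lt_omega0.1 (hlt'.trans (Ordinal.natCast_lt_omega0 k))
    exact hlt j (by exact_mod_cast hlt') (by simpa using hα)

lemma iter_natCast {D : Type u} [CompleteLattice D] (T : D → D) (k : ℕ) :
    iter T (k : Ordinal.{u}) = T^[k] ⊤ := by
  induction k with
  | zero => simp [iter, Ordinal.limitRecOn_zero]
  | succ k ih =>
    rw [Function.iterate_succ_apply', ← ih, Nat.cast_succ, iter, iter, Ordinal.limitRecOn_add_one]

lemma exists_iterate_succ_eq {D : Type u} [PartialOrder D] [Finite D] (T : D → D)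
    (hT : ∀ x, T x ≤ x) (x : D) : ∃ k : ℕ, T^[k + 1] x = T^[k] x := by
  have hanti : Antitone fun k => T^[k] x := antitone_nat_of_succ_le fun k => by
    rw [Function.iterate_succ_apply']; exact hT _
  obtain ⟨a, b, hab, h⟩ := Finite.exists_ne_map_eq_of_infinite fun k => T^[k] x
  wlog hlt : a < b generalizing a b
  · exact this b a hab.symm h.symm (lt_of_le_of_ne (not_lt.1 hlt) hab.symm)
  -- The value at `a` recurs at `b ≥ a + 1`, so antitonicity squeezes the value at `a + 1`.
  refine ⟨a, le_antisymm (hanti (Nat.le_succ a)) ?_⟩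
  exact h.le.trans (hanti hlt)

/-! ### Knowledge models -/

/-- Comparing at ambient points avoids heterogeneous equalities between fields typed over different
state sets. -/
lemma KnowledgeModel.ext_of_mem {n : ℕ} {S : Fin n → Type u} {W : Type u}
    {M N : KnowledgeModel S W} (hs : M.states = N.states)
    (hstr : ∀ i w (h : w ∈ M.states) (h' : w ∈ N.states), M.str i ⟨w, h⟩ = N.str i ⟨w, h'⟩)
    (hposs : ∀ i w (h : w ∈ M.states) (h' : w ∈ N.states) v (g : v ∈ M.states)
      (g' : v ∈ N.states), (⟨v, g⟩ : M.states) ∈ M.poss i ⟨w, h⟩ ↔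
        (⟨v, g'⟩ : N.states) ∈ N.poss i ⟨w, h'⟩) : M = N := by
  obtain ⟨A, s, P, _, _⟩ := M
  obtain ⟨B, t, Q, _, _⟩ := N
  dsimp only at hs hstr hposs
  subst hs
  obtain rfl : s = t := by
    funext i x
    exact hstr i x.1 x.2 x.2
  obtain rfl : P = Q := by
    funext i x
    ext y
    exact hposs i x.1 x.2 x.2 y.1 y.2 y.2
  rfl

/-- Changing the coordinate `j` of a state leaves the strategy of `i` alone, so player `i` cannot
exclude the new state. At `j = i` only the strategy played would remain. -/
lemma eventRestriction_poss_standard {n : ℕ} {S : Fin n → Type u} (G : Restriction S) (i : Fin n)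
    (ω : (standardKnowledgeModel G).states) (j : Fin n) (hj : j ≠ i) :
    (standardKnowledgeModel G).eventRestriction ((standardKnowledgeModel G).poss i ω) j = G j := by
  ext x
  constructor
  · rintro ⟨ω', -, rfl⟩
    exact ω'.2 j
  · intro hx
    refine ⟨⟨Function.update ω.1 j x, fun k => ?_⟩, ?_, ?_⟩
    · rcases eq_or_ne k j with rfl | hk
      · simpa using hx
      · simpa [hk] using ω.2 k
    · change ω.1 i = Function.update ω.1 j x i
      simp [hj.symm]
    · change Function.update ω.1 j x j = x
      simp

lemma announce_standard {n : ℕ} {S : Fin n → Type u} (φ : OptProperty S)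
    (hφ : ∀ i s (G G' : Restriction S), (∀ j, j ≠ i → G j = G' j) → (φ i s G ↔ φ i s G'))
    (G : Restriction S) :
    (standardKnowledgeModel G).announce ((standardKnowledgeModel G).ratEvent φ) =
      standardKnowledgeModel (elim φ G) := by
  refine KnowledgeModel.ext_of_mem ?_ (fun _ _ _ _ => rfl) (fun _ _ _ _ _ _ _ => Iff.rfl)
  ext w
  constructor
  · rintro ⟨h, hr⟩ i
    exact ⟨h i, (hφ i _ _ _ (eventRestriction_poss_standard G i ⟨w, h⟩)).1 (hr i)⟩
  · intro h
    exact ⟨fun i => (h i).1, fun i =>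
      (hφ i _ _ _ (eventRestriction_poss_standard G i ⟨w, fun i => (h i).1⟩)).2 (h i).2⟩

lemma iterAnnounce_standard_natCast {n : ℕ} {S : Fin n → Type u} (φ : OptProperty S)
    (hφ : ∀ i s (G G' : Restriction S), (∀ j, j ≠ i → G j = G' j) → (φ i s G ↔ φ i s G'))
    (G : Restriction S) (k : ℕ) :
    iterAnnounce φ (standardKnowledgeModel G) (k : Ordinal.{u}) =
      standardKnowledgeModel ((elim φ)^[k] G) := by
  induction k with
  | zero => simp [iterAnnounce, Ordinal.limitRecOn_zero]
  | succ k ih =>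
    rw [Function.iterate_succ_apply', ← announce_standard φ hφ, ← ih, Nat.cast_succ,
      iterAnnounce, iterAnnounce, Ordinal.limitRecOn_add_one]

/-- The states form the product of the components, and a nonempty product determines its factors by
projection; one empty factor would erase the others. -/
lemma standardKnowledgeModel_injOn {n : ℕ} {S : Fin n → Type u} {G G' : Restriction S}
    (hG : ∀ i, (G i).Nonempty) (hG' : ∀ i, (G' i).Nonempty)
    (h : standardKnowledgeModel G = standardKnowledgeModel G') : G = G' := by
  have hs : Set.pi Set.univ G = Set.pi Set.univ G' := by
    have := congrArg KnowledgeModel.states h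
    ext s
    simpa [standardKnowledgeModel] using Set.ext_iff.1 this s
  funext i
  rw [← Set.eval_image_univ_pi (Set.univ_pi_nonempty_iff.2 hG), hs,
    Set.eval_image_univ_pi (Set.univ_pi_nonempty_iff.2 hG')]

/-! ### Distributions and beliefs -/

lemma Delta_mono {X : Type w} [Fintype X] {A B : Set X} (h : A ⊆ B) : Delta A ⊆ Delta B :=
  fun _ hm => ⟨hm.1, fun x hx => hm.2 x fun hA => hx (h hA)⟩

lemma nonempty_of_mem_Delta {X : Type w} [Fintype X] {A : Set X} {m : X → ℝ} (hm : m ∈ Delta A) :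
    A.Nonempty := by
  by_contra hA
  have h : ∑ x, m x = 0 := Finset.sum_eq_zero fun x _ => hm.2 x fun hx => hA ⟨x, hx⟩
  exact one_ne_zero (hm.1.2.symm.trans h)

lemma single_mem_Delta {X : Type w} [Fintype X] [DecidableEq X] {A : Set X} {x : X} (hx : x ∈ A) :
    Pi.single x (1 : ℝ) ∈ Delta A :=
  ⟨single_mem_stdSimplex ℝ x, fun y hy =>
    Pi.single_eq_of_ne (by rintro rfl; exact hy hx) _⟩

lemma isCompact_Delta {X : Type w} [Fintype X] (A : Set X) : IsCompact (Delta A) := by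
  have : Delta A = stdSimplex ℝ X ∩ ⋂ x, ⋂ (_ : x ∉ A), {m | m x = 0} := by
    ext m
    simp [Delta]
  rw [this]
  refine (isCompact_stdSimplex ℝ X).inter_right ?_
  exact isClosed_iInter fun x => isClosed_iInter fun _ =>
    isClosed_eq (continuous_apply x) continuous_const

/-- Moving the mass that `m` puts on `s` to the distribution `q`. -/
lemma add_smul_sub_single_mem_Delta {X : Type w} [Fintype X] [DecidableEq X] {A : Set X}
    {m q : X → ℝ} (hm : m ∈ Delta A) (hq : q ∈ Delta A) (s : X) :
    m + m s • (q - Pi.single s 1) ∈ Delta A := by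
  have hval : ∀ x, (m + m s • (q - Pi.single s 1) : X → ℝ) x =
      m x + m s * (q x - (Pi.single s 1 : X → ℝ) x) := fun x => by simp
  refine ⟨⟨fun x => ?_, ?_⟩, fun x hx => ?_⟩
  · rw [hval]
    have h1 := mul_nonneg (hm.1.1 s) (hq.1.1 x)
    rcases eq_or_ne x s with rfl | hxs
    · rw [Pi.single_eq_same]; linarith
    · rw [Pi.single_eq_of_ne hxs]; linarith [hm.1.1 x]
  · simp only [hval, Finset.sum_add_distrib, ← Finset.mul_sum, Finset.sum_sub_distrib]
    rw [hm.1.2, hq.1.2, (single_mem_stdSimplex ℝ s).2]; ring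
  · rw [hval, hm.2 x hx, hq.2 x hx]
    rcases eq_or_ne x s with rfl | hxs
    · simp [hm.2 x hx]
    · simp [Pi.single_eq_of_ne hxs]

/-! ### Optimality criteria and their dependence on the opponents -/

section Optimality

variable {n : ℕ} {S : Fin n → Type u}

lemma oppSet_congr {i : Fin n} {G G' : Restriction S} (h : ∀ j, j ≠ i → G j = G' j) :
    oppSet G i = oppSet G' i := by
  ext o
  exact forall_congr' fun j => by rw [h j.1 j.2]

lemma oppSet_mono {G G' : Restriction S} (h : G ≤ G') (i : Fin n) : oppSet G i ⊆ oppSet G' i :=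
  fun _ ho j => h _ (ho j)

lemma oppSet_nonempty {G : Restriction S} (h : ∀ i, (G i).Nonempty) (i : Fin n) :
    (oppSet G i).Nonempty :=
  ⟨fun j => (h j).some, fun j => (h j).some_mem⟩

lemma elim_le (φ : OptProperty S) (G : Restriction S) : elim φ G ≤ G := fun _ _ hs => hs.1

variable [∀ i, Fintype (S i)] (p : Fin n → (∀ j, S j) → ℝ)

lemma continuous_mixedPayoff (i : Fin n) (o : Opp S i) :
    Continuous fun m : S i → ℝ => mixedPayoff p i m o := by
  unfold mixedPayoff
  fun_prop

lemma mixedPayoff_add_smul_sub (i : Fin n) (o : Opp S i) (m q r : S i → ℝ) (c : ℝ) :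
    mixedPayoff p i (m + c • (q - r)) o =
      mixedPayoff p i m o + c * (mixedPayoff p i q o - mixedPayoff p i r o) := by
  simp only [mixedPayoff, Pi.add_apply, Pi.smul_apply, Pi.sub_apply, smul_eq_mul, mul_sub,
    Finset.mul_sum, ← Finset.sum_sub_distrib, ← Finset.sum_add_distrib]
  exact Finset.sum_congr rfl fun x _ => by ring

lemma mixedPayoff_single [∀ i, DecidableEq (S i)] (i : Fin n) (o : Opp S i) (s : S i) :
    mixedPayoff p i (Pi.single s 1) o = p i (joint i s o) := by
  simp [mixedPayoff, Pi.single_apply]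

/-- Replacing each pure strategy `t` in the mixed strategy `m` by the mixed strategy `f t`. -/
lemma exists_mixedPayoff_le {i : Fin n} {A : Set (S i)} {B : Set (Opp S i)}
    (h : ∀ t, ∃ m ∈ Delta A, ∀ o ∈ B, p i (joint i t o) ≤ mixedPayoff p i m o)
    {m : S i → ℝ} (hm : m ∈ stdSimplex ℝ (S i)) :
    ∃ m' ∈ Delta A, ∀ o ∈ B, mixedPayoff p i m o ≤ mixedPayoff p i m' o := by
  choose f hf hle using h
  refine ⟨fun x => ∑ t, m t * f t x, ⟨⟨fun x => ?_, ?_⟩, fun x hx => ?_⟩, fun o ho => ?_⟩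
  · exact Finset.sum_nonneg fun t _ => mul_nonneg (hm.1 t) ((hf t).1.1 x)
  · rw [Finset.sum_comm]
    simp only [← Finset.mul_sum, (hf _).1.2, mul_one, hm.2]
  · exact Finset.sum_eq_zero fun t _ => by rw [(hf t).2 x hx, mul_zero]
  · calc mixedPayoff p i m o ≤ ∑ t, m t * mixedPayoff p i (f t) o :=
          Finset.sum_le_sum fun t _ => mul_le_mul_of_nonneg_left (hle t o ho) (hm.1 t)
      _ = _ := by
          simp only [mixedPayoff, Finset.mul_sum, Finset.sum_mul]
          rw [Finset.sum_comm]
          exact Finset.sum_congr rfl fun x _ => Finset.sum_congr rfl fun t _ => by ring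

/-- The beliefs of player `i` of the given kind held in `G`, as distributions on the joint
strategies of the opponents. -/
def beliefs (b : BeliefKind) (i : Fin n) (G : Restriction S) : Set (Opp S i → ℝ) :=
  open Classical in
  match b with
  | .pureJoint => {μ | ∃ o ∈ oppSet G i, μ = Pi.single o 1}
  | .mixedJoint => {μ | ∃ m : ∀ j : {j : Fin n // j ≠ i}, S j → ℝ,
      (∀ j : {j : Fin n // j ≠ i}, m j ∈ Delta (G j)) ∧ μ = fun o => ∏ j, m j (o j)}
  | .correlated => Delta (oppSet G i)

lemma beliefPayoff_single (i : Fin n) [DecidableEq (Opp S i)] (s : S i) (o : Opp S i) :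
    beliefPayoff p i s (Pi.single o 1) = p i (joint i s o) := by
  simp [beliefPayoff, Pi.single_apply]

/-- Once beliefs are distributions on the opponents' joint strategies, the three kinds can be
treated together. -/
lemma isBestResponse_iff (b : BeliefKind) (i : Fin n) (s : S i) (G : Restriction S)
    (C : Set (S i)) : IsBestResponse p b i s G C ↔
      ∃ μ ∈ beliefs b i G, ∀ t ∈ C, beliefPayoff p i t μ ≤ beliefPayoff p i s μ := by
  cases b with
  | pureJoint =>
    constructor
    · rintro ⟨o, ho, h⟩
      exact ⟨_, ⟨o, ho, rfl⟩, by simpa only [beliefPayoff_single] using h⟩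
    · rintro ⟨_, ⟨o, ho, rfl⟩, h⟩
      exact ⟨o, ho, by simpa only [beliefPayoff_single] using h⟩
  | mixedJoint =>
    constructor
    · rintro ⟨m, hm, h⟩
      exact ⟨_, ⟨m, hm, rfl⟩, h⟩
    · rintro ⟨_, ⟨m, hm, rfl⟩, h⟩
      exact ⟨m, hm, h⟩
  | correlated => exact Iff.rfl

lemma beliefs_mono (b : BeliefKind) (i : Fin n) {G G' : Restriction S} (h : G ≤ G') :
    beliefs b i G ⊆ beliefs b i G' := by
  cases b with
  | pureJoint => exact fun _ ⟨o, ho, e⟩ => ⟨o, oppSet_mono h i ho, e⟩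
  | mixedJoint => exact fun _ ⟨m, hm, e⟩ => ⟨m, fun j => Delta_mono (h j) (hm j), e⟩
  | correlated => exact Delta_mono (oppSet_mono h i)

lemma beliefs_congr (b : BeliefKind) {i : Fin n} {G G' : Restriction S}
    (h : ∀ j, j ≠ i → G j = G' j) : beliefs b i G = beliefs b i G' := by
  cases b with
  | pureJoint => simp only [beliefs, oppSet_congr h]
  | mixedJoint =>
    have : ∀ j : {j : Fin n // j ≠ i}, G j = G' j := fun j => h j j.2
    simp only [beliefs, this]
  | correlated => simp only [beliefs, oppSet_congr h]

lemma beliefs_nonempty (b : BeliefKind) {G : Restriction S} (h : ∀ i, (G i).Nonempty)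
    (i : Fin n) : (beliefs b i G).Nonempty := by
  classical
  cases b with
  | pureJoint => exact ⟨_, _, (oppSet_nonempty h i).some_mem, rfl⟩
  | mixedJoint =>
    exact ⟨_, fun j => Pi.single (h j).some 1, fun j => single_mem_Delta (h j).some_mem, rfl⟩
  | correlated => exact ⟨_, single_mem_Delta (oppSet_nonempty h i).some_mem⟩

lemma Criterion.holds_congr (φ : Criterion) (i : Fin n) (s : S i) {G G' : Restriction S}
    (h : ∀ j, j ≠ i → G j = G' j) (C : Set (S i)) :
    φ.Holds p i s G C ↔ φ.Holds p i s G' C := by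
  cases φ with
  | br b => simp only [Criterion.Holds, isBestResponse_iff, beliefs_congr b h]
  | _ => simp only [Criterion.Holds, oppSet_congr h]

/-! ### Undominated improvements -/

/-- Among the strategies weakly better than `t`, take one with maximal payoff summed over `B`; a
dominator of it would be a candidate with a larger sum. -/
lemma exists_undominated {i : Fin n} (A : Set (S i)) (B : Set (Opp S i)) {t : S i} (ht : t ∈ A) :
    ∃ u ∈ A, (∀ o ∈ B, p i (joint i t o) ≤ p i (joint i u o)) ∧
      ¬ ∃ v ∈ A, (∀ o ∈ B, p i (joint i u o) ≤ p i (joint i v o)) ∧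
        ∃ o ∈ B, p i (joint i u o) < p i (joint i v o) := by
  classical
  obtain ⟨u, ⟨huA, hu⟩, hmax⟩ := Set.exists_max_image
    {u | u ∈ A ∧ ∀ o ∈ B, p i (joint i t o) ≤ p i (joint i u o)}
    (fun u => ∑ o ∈ B.toFinset, p i (joint i u o)) (Set.toFinite _) ⟨t, ht, fun _ _ => le_rfl⟩
  refine ⟨u, huA, hu, ?_⟩
  rintro ⟨v, hvA, hv, o, ho, hlt⟩
  refine (hmax v ⟨hvA, fun o ho => (hu o ho).trans (hv o ho)⟩).not_gt ?_
  exact Finset.sum_lt_sum (fun o ho => hv o (Set.mem_toFinset.1 ho))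
    ⟨o, Set.mem_toFinset.2 ho, hlt⟩

/-- Compactness gives a maximiser of the summed payoff. If a pure strategy in its support were
dominated by `q`, shifting its mass to `q` would increase the sum. The conclusion concerns the
support because elimination acts on pure strategies. -/
lemma exists_mixed_undominated {i : Fin n} (A : Set (S i)) (B : Set (Opp S i)) {m : S i → ℝ}
    (hm : m ∈ Delta A) :
    ∃ m' ∈ Delta A, (∀ o ∈ B, mixedPayoff p i m o ≤ mixedPayoff p i m' o) ∧
      ∀ s, m' s ≠ 0 → ¬ ∃ q ∈ Delta A,
        (∀ o ∈ B, p i (joint i s o) ≤ mixedPayoff p i q o) ∧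
          ∃ o ∈ B, p i (joint i s o) < mixedPayoff p i q o := by
  classical
  have hcomp : IsCompact (Delta A ∩ ⋂ o ∈ B,
      {m' : S i → ℝ | mixedPayoff p i m o ≤ mixedPayoff p i m' o}) :=
    (isCompact_Delta A).inter_right (isClosed_biInter fun o _ =>
      isClosed_le continuous_const (continuous_mixedPayoff p i o))
  obtain ⟨m', ⟨hm'A, hm'⟩, hmax⟩ := hcomp.exists_isMaxOn ⟨m, hm, by simp⟩
    (f := fun m' => ∑ o ∈ B.toFinset, mixedPayoff p i m' o)
    (continuous_finsetSum _ fun o _ => continuous_mixedPayoff p i o).continuousOn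
  simp only [Set.mem_iInter, Set.mem_ofPred_eq] at hm'
  refine ⟨m', hm'A, hm', ?_⟩
  rintro s hs ⟨q, hq, hle, o₀, ho₀, hlt⟩
  have hpos : 0 < m' s := lt_of_le_of_ne (hm'A.1.1 s) hs.symm
  have hval : ∀ o, mixedPayoff p i (m' + m' s • (q - Pi.single s 1)) o =
      mixedPayoff p i m' o + m' s * (mixedPayoff p i q o - p i (joint i s o)) := fun o => by
    rw [mixedPayoff_add_smul_sub, mixedPayoff_single]
  have hge : ∀ o ∈ B, mixedPayoff p i m' o ≤
      mixedPayoff p i (m' + m' s • (q - Pi.single s 1)) o := fun o ho => by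
    rw [hval]
    linarith [mul_nonneg hpos.le (sub_nonneg.2 (hle o ho))]
  refine (isMaxOn_iff.1 hmax _ ⟨add_smul_sub_single_mem_Delta hm'A hq s, ?_⟩).not_gt ?_
  · simp only [Set.mem_iInter, Set.mem_ofPred_eq]
    exact fun o ho => (hm' o ho).trans (hge o ho)
  · refine Finset.sum_lt_sum (fun o ho => hge o (Set.mem_toFinset.1 ho))
      ⟨o₀, Set.mem_toFinset.2 ho₀, ?_⟩
    rw [hval]
    linarith [mul_pos hpos (sub_pos.2 hlt)]

/-! ### Restrictions in which every strategy of the initial game can be matched -/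

/-- Every strategy of the initial game is matched by one available to player `i` in `G`: against
all joint strategies of the opponents in `G` or, for `br`, against each belief held in `G`. -/
def Criterion.Matched (φ : Criterion) (i : Fin n) (G : Restriction S) : Prop :=
  match φ with
  | .sd | .wd => ∀ t, ∃ u ∈ G i, ∀ o ∈ oppSet G i, p i (joint i t o) ≤ p i (joint i u o)
  | .msd | .mwd => ∀ t, ∃ m ∈ Delta (G i), ∀ o ∈ oppSet G i,
      p i (joint i t o) ≤ mixedPayoff p i m o
  | .br b => ∀ μ ∈ beliefs b i G, ∀ t, ∃ u ∈ G i, beliefPayoff p i t μ ≤ beliefPayoff p i u μ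

lemma Criterion.matched_top (φ : Criterion) (i : Fin n) :
    φ.Matched p i (⊤ : Restriction S) := by
  classical
  have hpure : ∀ t : S i, ∃ u ∈ (⊤ : Restriction S) i, ∀ o ∈ oppSet ⊤ i,
      p i (joint i t o) ≤ p i (joint i u o) := fun t => ⟨t, trivial, fun _ _ => le_rfl⟩
  have hmixed : ∀ t : S i, ∃ m ∈ Delta ((⊤ : Restriction S) i), ∀ o ∈ oppSet ⊤ i,
      p i (joint i t o) ≤ mixedPayoff p i m o := fun t =>
    ⟨Pi.single t 1, single_mem_Delta trivial, fun o _ => (mixedPayoff_single p i o t).ge⟩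
  cases φ with
  | sd => exact hpure
  | wd => exact hpure
  | msd => exact hmixed
  | mwd => exact hmixed
  | br b => exact fun μ _ t => ⟨t, trivial, le_rfl⟩

variable {p}

/-- If every strategy of the initial game is matched in `G`, then comparison with the strategies
in `G` and in the initial game yield the same notion of optimality on `G`. -/
lemma Criterion.Matched.localProp_iff {φ : Criterion} {i : Fin n} {G : Restriction S}
    (hG : φ.Matched p i G) (s : S i) : φ.localProp p i s G ↔ φ.globalProp p i s G := by
  cases φ with
  | sd =>
    refine not_congr ⟨fun ⟨t, _, h⟩ => ⟨t, trivial, h⟩, fun ⟨t, _, h⟩ => ?_⟩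
    obtain ⟨u, hu, hle⟩ := hG t
    exact ⟨u, hu, fun o ho => (h o ho).trans_le (hle o ho)⟩
  | wd =>
    refine not_congr ⟨fun ⟨t, _, h⟩ => ⟨t, trivial, h⟩, fun ⟨t, _, h, o, ho, hlt⟩ => ?_⟩
    obtain ⟨u, hu, hle⟩ := hG t
    exact ⟨u, hu, fun o ho => (h o ho).trans (hle o ho), o, ho, hlt.trans_le (hle o ho)⟩
  | msd =>
    refine not_congr ⟨fun ⟨m, hm, h⟩ => ⟨m, Delta_mono (Set.subset_univ _) hm, h⟩,
      fun ⟨m, hm, h⟩ => ?_⟩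
    -- The dominating mixture may use eliminated strategies; each is replaced by its match, with
    -- payoffs averaged linearly.
    obtain ⟨u, hu, hle⟩ := exists_mixedPayoff_le p hG hm.1
    exact ⟨u, hu, fun o ho => (h o ho).trans_le (hle o ho)⟩
  | mwd =>
    refine not_congr ⟨fun ⟨m, hm, h⟩ => ⟨m, Delta_mono (Set.subset_univ _) hm, h⟩,
      fun ⟨m, hm, h, o, ho, hlt⟩ => ?_⟩
    obtain ⟨u, hu, hle⟩ := exists_mixedPayoff_le p hG hm.1
    exact ⟨u, hu, fun o ho => (h o ho).trans (hle o ho), o, ho, hlt.trans_le (hle o ho)⟩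
  | br b =>
    simp only [Criterion.localProp, Criterion.globalProp, Criterion.Holds, isBestResponse_iff]
    refine ⟨fun ⟨μ, hμ, h⟩ => ⟨μ, hμ, fun t _ => ?_⟩, fun ⟨μ, hμ, h⟩ =>
      ⟨μ, hμ, fun t _ => h t trivial⟩⟩
    obtain ⟨u, hu, hle⟩ := hG μ hμ t
    exact hle.trans (h u hu)

/-- A match in `G` improves to an undominated one, which survives. For `br`, a belief held after
elimination was already held in `G`, and a best response to it in `G i` survives and matches every
strategy. -/
lemma Criterion.Matched.elim_localProp {φ : Criterion} {G : Restriction S}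
    (hne : ∀ i, (G i).Nonempty) {i : Fin n} (hG : φ.Matched p i G) :
    φ.Matched p i (elim (φ.localProp p) G) := by
  have hopp := oppSet_mono (elim_le (φ.localProp p) G) i
  -- With `o₀` available, strict dominance implies weak dominance, so weakly undominated strategies
  -- also survive `sd` and `msd`.
  obtain ⟨o₀, ho₀⟩ := oppSet_nonempty hne i
  cases φ with
  | sd =>
    intro t
    obtain ⟨t', ht', hle⟩ := hG t
    obtain ⟨u, hu, hle', hund⟩ := exists_undominated p (G i) (oppSet G i) ht'
    refine ⟨u, ⟨hu, fun ⟨v, hv, hlt⟩ => hund ⟨v, hv, fun o ho => (hlt o ho).le, o₀, ho₀,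
      hlt o₀ ho₀⟩⟩, fun o ho => (hle o (hopp ho)).trans (hle' o (hopp ho))⟩
  | wd =>
    intro t
    obtain ⟨t', ht', hle⟩ := hG t
    obtain ⟨u, hu, hle', hund⟩ := exists_undominated p (G i) (oppSet G i) ht'
    exact ⟨u, ⟨hu, hund⟩, fun o ho => (hle o (hopp ho)).trans (hle' o (hopp ho))⟩
  | msd =>
    intro t
    obtain ⟨m, hm, hle⟩ := hG t
    obtain ⟨m', hm', hle', hund⟩ := exists_mixed_undominated p (G i) (oppSet G i) hm
    refine ⟨m', ⟨hm'.1, fun s hs => ?_⟩, fun o ho => (hle o (hopp ho)).trans (hle' o (hopp ho))⟩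
    by_contra h0
    refine hs ⟨by_contra fun hsG => h0 (hm'.2 s hsG), fun ⟨q, hq, hlt⟩ =>
      hund s h0 ⟨q, hq, fun o ho => (hlt o ho).le, o₀, ho₀, hlt o₀ ho₀⟩⟩
  | mwd =>
    intro t
    obtain ⟨m, hm, hle⟩ := hG t
    obtain ⟨m', hm', hle', hund⟩ := exists_mixed_undominated p (G i) (oppSet G i) hm
    refine ⟨m', ⟨hm'.1, fun s hs => ?_⟩, fun o ho => (hle o (hopp ho)).trans (hle' o (hopp ho))⟩
    by_contra h0
    exact hs ⟨by_contra fun hsG => h0 (hm'.2 s hsG), hund s h0⟩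
  | br b =>
    intro μ hμ t
    have hμG := beliefs_mono b i (elim_le _ G) hμ
    obtain ⟨u, hu, hmax⟩ := Set.exists_max_image (G i) (fun u => beliefPayoff p i u μ)
      (Set.toFinite _) (hne i)
    obtain ⟨t', ht', hle⟩ := hG μ hμG t
    exact ⟨u, ⟨hu, (isBestResponse_iff p b i u G _).2 ⟨μ, hμG, hmax⟩⟩, hle.trans (hmax t' ht')⟩

lemma Criterion.Matched.nonempty_elim {φ : Criterion} {G : Restriction S}
    (hne : ∀ i, (G i).Nonempty) {i : Fin n} (hG : φ.Matched p i G) :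
    (elim (φ.localProp p) G i).Nonempty := by
  have h := hG.elim_localProp hne
  obtain ⟨t, -⟩ := hne i
  cases φ with
  | sd => obtain ⟨u, hu, -⟩ := h t; exact ⟨u, hu⟩
  | wd => obtain ⟨u, hu, -⟩ := h t; exact ⟨u, hu⟩
  | msd => obtain ⟨m, hm, -⟩ := h t; exact nonempty_of_mem_Delta hm
  | mwd => obtain ⟨m, hm, -⟩ := h t; exact nonempty_of_mem_Delta hm
  | br b =>
    -- The match `h` needs a belief held after elimination, whose existence is not yet known; a
    -- belief held in `G` is used instead.
    obtain ⟨μ, hμ⟩ := beliefs_nonempty b hne i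
    obtain ⟨u, hu, hmax⟩ := Set.exists_max_image (G i) (fun u => beliefPayoff p i u μ)
      (Set.toFinite _) (hne i)
    exact ⟨u, hu, (isBestResponse_iff p b i u G _).2 ⟨μ, hμ, hmax⟩⟩

variable (p)

/-- The two claims are proved together: preserving either one uses both at the previous stage. -/
lemma Criterion.matched_iterate [∀ i, Nonempty (S i)] (φ : Criterion) (k : ℕ) :
    (∀ i, ((elim (φ.localProp p))^[k] ⊤ i).Nonempty) ∧
      ∀ i, φ.Matched p i ((elim (φ.localProp p))^[k] ⊤) := by
  induction k with
  | zero => exact ⟨fun i => Set.univ_nonempty, fun i => φ.matched_top p i⟩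
  | succ k ih =>
    simp only [Function.iterate_succ_apply']
    exact ⟨fun i => (ih.2 i).nonempty_elim ih.1, fun i => (ih.2 i).elim_localProp ih.1⟩

lemma Criterion.iterate_globalProp [∀ i, Nonempty (S i)] (φ : Criterion) (k : ℕ) :
    (elim (φ.globalProp p))^[k] ⊤ = (elim (φ.localProp p))^[k] ⊤ := by
  induction k with
  | zero => rfl
  | succ k ih =>
    rw [Function.iterate_succ_apply', Function.iterate_succ_apply', ih]
    funext i
    ext s
    exact and_congr_right fun _ => (((φ.matched_iterate p k).2 i).localProp_iff s).symm

end Optimality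

end EpistemicGames

theorem mainTheorem8 {n : ℕ} (hn : 1 < n) (S : Fin n → Type*)
    [∀ i, Fintype (S i)] [∀ i, Nonempty (S i)]
    (p : Fin n → (∀ j, S j) → ℝ) (φ : EpistemicGames.Criterion) :
    ∃ R : EpistemicGames.Restriction S,
      EpistemicGames.IsOutcome
        (EpistemicGames.iter (EpistemicGames.elim (φ.localProp p))) R ∧
      EpistemicGames.IsOutcome
        (EpistemicGames.iterAnnounce (φ.globalProp p)
          (EpistemicGames.standardKnowledgeModel (⊤ : EpistemicGames.Restriction S)))
        (EpistemicGames.standardKnowledgeModel R) := by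
  classical
  have hex := exists_iterate_succ_eq (elim (φ.localProp p)) (elim_le _) ⊤
  have hmodel : ∀ k : ℕ, iterAnnounce (φ.globalProp p) (standardKnowledgeModel ⊤) (k : Ordinal) =
      standardKnowledgeModel ((elim (φ.localProp p))^[k] ⊤) := fun k => by
    rw [iterAnnounce_standard_natCast _ (fun i s _ _ h => φ.holds_congr p i s h _),
      φ.iterate_globalProp]
  refine ⟨(elim (φ.localProp p))^[Nat.find hex] ⊤, ?_, ?_⟩
  · rw [← iter_natCast]
    refine isOutcome_of_nat _ _ ?_ fun j hj => ?_
    · simpa only [iter_natCast] using Nat.find_spec hex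
    · simpa only [iter_natCast] using Nat.find_min hex hj
  · rw [← hmodel]
    refine isOutcome_of_nat _ _ ?_ fun j hj h => Nat.find_min hex hj ?_
    · rw [hmodel, hmodel, Nat.find_spec hex]
    · rw [hmodel, hmodel] at h
      -- An earlier stop of the models would force an earlier stop of the restrictions, since all
      -- iterates are nonempty.
      exact standardKnowledgeModel_injOn (φ.matched_iterate p _).1 (φ.matched_iterate p _).1 h
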